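/- Let $X$ be a real or complex Banach space and let $(R_\lambda)_{\lambda\in\Lambda}$ be a family of linear projections on $X$, indexed by an up-directed set $\Lambda$, such that: (i) $\sup_{\lambda\in\Lambda}\|R_\lambda\|<\infty$; (ii) $R_\lambda[X]$ is weakly Lindelöf determined for each $\lambda\in\Lambda$; (iii) $R_\lambda R_\mu=R_\mu R_\lambda=R_\lambda$ whenever $\lambda\le\mu$; (iv) if $\lambda_1\le\lambda_2\le\dots$ are in $\Lambda$, then $\lambda=\sup_n\lambda_n$ exists in $\Lambda$ and $R_\lambda[X]=\overline{\bigcup_n R_{\lambda_n}[X]}$; (v) $X=\bigcup_{\lambda\in\Lambda}R_\lambda[X]$. Then there is a projectional skeleton $(P_i)_{i\in I}$ on $X$ whose induced subspace of $X^*$ is $\bigcup_{i\in I}P_i^*[X^*]=\bigcup_{\lambda\in\Lambda}R_\lambda^*[X^*]$. Here a Banach space $Y$ is weakly Lindelöf determined (WLD) if there is a set $M\subset Y$ with dense linear span such that $\{m\in M: y^*(m)\neq0\}$ is countable for every $y^*\in Y^*$. A projectional skeleton on $X$ is a family $(P_i)_{i\in I}$ of linear projections on $X$, indexed by an up-directed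 partially ordered set $I$, which satisfies (i), (iii), (iv) and (v) (with $P_i$ in place of $R_\lambda$) and such that $P_i[X]$ is separable for each $i\in I$. The subspace of $X^*$ induced by it is $\bigcup_{i\in I}P_i^*[X^*]$. -/

import Mathlib

universe u v w

/-- The union `⋃ i, (P i)* [X*]` of the ranges of the adjoints `(P i)* : f ↦ f ∘ P i` of a family
of bounded operators `P i` on `X`. If `P` is a projectional skeleton, this is the subspace of `X*`
induced by the skeleton. -/
def inducedSubspace {𝕜 : Type u} [RCLike 𝕜] {X : Type v} [NormedAddCommGroup X]
    [NormedSpace 𝕜 X] {I : Type w} (P : I → X →L[𝕜] X) : Set (StrongDual 𝕜 X) :=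
  ⋃ i, Set.range fun f : StrongDual 𝕜 X => f.comp (P i)

/-- A subspace `D` of `X*` is a `Σ`-subspace if there is a linearly dense set `M ⊆ X` such that
`D` consists exactly of the functionals that are nonzero at only countably many points of `M`. -/
def IsSigmaSubspace {𝕜 : Type u} [RCLike 𝕜] {X : Type v} [NormedAddCommGroup X]
    [NormedSpace 𝕜 X] (D : Submodule 𝕜 (StrongDual 𝕜 X)) : Prop :=
  ∃ M : Set X, Dense (Submodule.span 𝕜 M : Set X) ∧
    (D : Set (StrongDual 𝕜 X)) = {f | {m ∈ M | f m ≠ 0}.Countable}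

/-- A space is weakly Lindelöf determined if its whole dual is a `Σ`-subspace of itself. -/
def IsWLD (𝕜 : Type u) [RCLike 𝕜] (X : Type v) [NormedAddCommGroup X] [NormedSpace 𝕜 X] : Prop :=
  IsSigmaSubspace (⊤ : Submodule 𝕜 (StrongDual 𝕜 X))

/-- A projectional skeleton on `X`, indexed by the up-directed set `I`. -/
structure IsProjectionalSkeleton {𝕜 : Type u} [RCLike 𝕜] {X : Type v} [NormedAddCommGroup X]
    [NormedSpace 𝕜 X] {I : Type w} [PartialOrder I] (P : I → X →L[𝕜] X) : Prop where
  directed : ∀ i j : I, ∃ k, i ≤ k ∧ j ≤ k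
  projection : ∀ i, P i ∘L P i = P i
  bounded : ∃ C : ℝ, ∀ i, ‖P i‖ ≤ C
  separable : ∀ i, TopologicalSpace.IsSeparable (Set.range (P i))
  compatible : ∀ i j, i ≤ j → P i ∘L P j = P i ∧ P j ∘L P i = P i
  sup_complete : ∀ s : ℕ → I, Monotone s →
    ∃ i, IsLUB (Set.range s) i ∧ Set.range (P i) = closure (⋃ n, Set.range (P (s n)))
  cover : ⋃ i, Set.range (P i) = Set.univ

/-! Let `D` be the subspace induced by `R`. The projections come from countable pairs `A ⊆ X`, `B ⊆
D`, saturated so that the closure of `A` and the common kernel of `B` are complementary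
(`IsSaturated.exists_projection`). The two are transversal because `B` contains norming functionals
for `A`.

Their sum is dense by the WLD property. Growing finite lists in `B` get growing indices, whose
supremum `k` satisfies `f ∘ R k = f` for `f ∈ B`; so `x - R k x` lies in the common kernel. The
range of `R k` is approximated by the spans of the WLD sets of these indices, and each vector of
such a set is in `A` or killed by `B`. Only indices of lists enter saturation, never `k` itself, so
countably many suffice and saturation survives increasing unions.

Ordered by inclusion, the saturated pairs index the skeleton. It induces `D`, since `P = P ∘ R k`
and `f ∘ P = f` for `f ∈ B`. -/

open Set

/-! ### Complemented subspaces -/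

section Projection

variable {𝕜 : Type u} [RCLike 𝕜] {X : Type v} [NormedAddCommGroup X] [NormedSpace 𝕜 X]

/-- Two closed subspaces with dense sum, the first of which is bounded with respect to the sum,
are the range and the kernel of a bounded projection. -/
theorem Submodule.exists_projection_of_dense_sup [CompleteSpace X] {Y Z : Submodule 𝕜 X}
    (hY : IsClosed (Y : Set X)) (hZ : IsClosed (Z : Set X)) {C : ℝ} (hC : 0 ≤ C)
    (h : ∀ y ∈ Y, ∀ z ∈ Z, ‖y‖ ≤ C * ‖y + z‖) (hd : Dense ((Y ⊔ Z : Submodule 𝕜 X) : Set X)) :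
    ∃ P : X →L[𝕜] X, (∀ x, P x ∈ Y) ∧ (∀ x, x - P x ∈ Z) ∧ (∀ y ∈ Y, P y = y) ∧
      (∀ z ∈ Z, P z = 0) ∧ ‖P‖ ≤ C := by
  have hdisj : Disjoint Y Z := by
    rw [Submodule.disjoint_def]
    intro x hx hx'
    simpa using h x hx (-x) (Z.neg_mem hx')
  have hclosed : IsClosed ((Y ⊔ Z : Submodule 𝕜 X) : Set X) := by
    have := hY.completeSpace_coe
    have := hZ.completeSpace_coe
    let T : (Y × Z) →L[𝕜] X := Y.subtypeL.coprod Z.subtypeL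
    -- The constant is `C + 1` because `‖z‖ ≤ ‖y + z‖ + ‖y‖`. Being bounded below on a complete
    -- space, the sum map has closed range.
    have hT : AntilipschitzWith (C + 1).toNNReal T := by
      refine T.antilipschitz_of_bound ?_
      rintro ⟨y, z⟩
      have h1 := h y y.2 z z.2
      have h2 : ‖(z : X)‖ ≤ ‖(y : X) + z‖ + ‖(y : X)‖ := by
        simpa [add_comm] using norm_sub_le ((y : X) + z) y
      rw [Real.coe_toNNReal _ (by positivity)]
      have h0 := norm_nonneg ((y : X) + z)
      change max ‖(y : X)‖ ‖(z : X)‖ ≤ (C + 1) * ‖(y : X) + z‖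
      exact max_le (by linarith) (by linarith)
    have hr : ((Y ⊔ Z : Submodule 𝕜 X) : Set X) = range T := by
      ext x
      simp only [SetLike.mem_coe, Submodule.mem_sup, mem_range, Prod.exists, Subtype.exists]
      simp [T]
    rw [hr]
    exact hT.isClosed_range T.uniformContinuous
  have hsup : ∀ x, ∃ y ∈ Y, ∃ z ∈ Z, y + z = x := fun x =>
    Submodule.mem_sup.1 (hclosed.closure_subset (hd x))
  have hc : IsCompl Y Z := ⟨hdisj, codisjoint_iff.2 <| eq_top_iff.2 fun x _ =>
    Submodule.mem_sup.2 (hsup x)⟩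
  let p : X →ₗ[𝕜] X := Y.projection Z hc
  have hpY : ∀ y ∈ Y, p y = y := fun y hy => Submodule.projection_apply_left hc ⟨y, hy⟩
  have hpZ : ∀ z ∈ Z, p z = 0 := fun z hz => Submodule.projection_apply_right hc ⟨z, hz⟩
  have key : ∀ x, p x ∈ Y ∧ x - p x ∈ Z := by
    intro x
    obtain ⟨y, hy, z, hz, rfl⟩ := hsup x
    rw [map_add, hpY y hy, hpZ z hz]
    simpa using ⟨hy, hz⟩
  refine ⟨p.mkContinuous C fun x => ?_, fun x => (key x).1, fun x => (key x).2, hpY, hpZ,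
    LinearMap.mkContinuous_norm_le _ hC _⟩
  simpa using h _ (key x).1 _ (key x).2

end Projection

/-! ### Saturated countable pairs -/

section Saturated

variable {𝕜 : Type u} [RCLike 𝕜] {X : Type v} [NormedAddCommGroup X] [NormedSpace 𝕜 X]

/-- A pair consisting of a countable set of vectors and a countable set of functionals from `D` is
saturated if it is closed under linear combinations with coefficients in `Q`, under the choice `φ`
of a functional for each vector, and if it contains the support on `M l` of each of its functionals,
for every finite list `l` of its functionals. -/
structure IsSaturated (Q : Set 𝕜) (φ : X → StrongDual 𝕜 X) (M : List (StrongDual 𝕜 X) → Set X)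
    (D : Set (StrongDual 𝕜 X)) (S : Set X × Set (StrongDual 𝕜 X)) : Prop where
  countable_fst : S.1.Countable
  countable_snd : S.2.Countable
  zero_mem : 0 ∈ S.1
  add_mem : ∀ x ∈ S.1, ∀ y ∈ S.1, x + y ∈ S.1
  smul_mem : ∀ q ∈ Q, ∀ x ∈ S.1, q • x ∈ S.1
  subset : S.2 ⊆ D
  functional_mem : ∀ x ∈ S.1, φ x ∈ S.2
  support_mem : ∀ f ∈ S.2, ∀ l : List (StrongDual 𝕜 X), (∀ g ∈ l, g ∈ S.2) →
    ∀ m ∈ M l, f m ≠ 0 → m ∈ S.1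

variable {Q : Set 𝕜} {φ : X → StrongDual 𝕜 X} {M : List (StrongDual 𝕜 X) → Set X}
  {D : Set (StrongDual 𝕜 X)}

theorem List.exists_forall_mem_of_monotone {α : Type*} {s : ℕ → Set α} (hs : Monotone s) :
    ∀ l : List α, (∀ a ∈ l, a ∈ ⋃ n, s n) → ∃ n, ∀ a ∈ l, a ∈ s n
  | [], _ => ⟨0, by simp⟩
  | b :: l, h => by
    obtain ⟨n, hn⟩ := exists_forall_mem_of_monotone hs l fun a ha => h a (by simp [ha])
    obtain ⟨k, hk⟩ := mem_iUnion.1 (h b (by simp))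
    refine ⟨max n k, fun a ha => ?_⟩
    rcases List.mem_cons.1 ha with rfl | ha
    · exact hs (le_max_right n k) hk
    · exact hs (le_max_left n k) (hn a ha)

/-- Each stage adds what the conditions demand of the previous one. This is countable, as supports
are countable and a countable set has countably many finite lists. Every condition involves finitely
many elements, so the union of the stages is saturated. -/
theorem exists_isSaturated_ge (hQ : Q.Countable) (hφ : ∀ x, φ x ∈ D)
    (hM : ∀ l, ∀ f : StrongDual 𝕜 X, {m ∈ M l | f m ≠ 0}.Countable)
    {S : Set X × Set (StrongDual 𝕜 X)} (h1 : S.1.Countable) (h2 : S.2.Countable) (hD : S.2 ⊆ D) :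
    ∃ T, S ≤ T ∧ IsSaturated Q φ M D T := by
  let F : Set X × Set (StrongDual 𝕜 X) → Set X × Set (StrongDual 𝕜 X) := fun T =>
    (T.1 ∪ ({0} ∪ (image2 (· + ·) T.1 T.1 ∪ (image2 (· • ·) Q T.1 ∪
      ⋃ p : T.2 × List T.2, {m ∈ M (p.2.map Subtype.val) | p.1.1 m ≠ 0}))), T.2 ∪ φ '' T.1)
  let s : ℕ → Set X × Set (StrongDual 𝕜 X) := fun n => F^[n] S
  have hs : ∀ n, s (n + 1) = F (s n) := fun n => Function.iterate_succ_apply' F n S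
  have hle : ∀ n, s n ≤ s (n + 1) := fun n => by
    rw [hs]
    exact ⟨subset_union_left, subset_union_left⟩
  have hmono : Monotone s := monotone_nat_of_le_succ hle
  have hmono1 : Monotone fun n => (s n).1 := fun i j h => (hmono h).1
  have hmono2 : Monotone fun n => (s n).2 := fun i j h => (hmono h).2
  have hcount : ∀ n, (s n).1.Countable ∧ (s n).2.Countable ∧ (s n).2 ⊆ D := by
    intro n
    induction n with
    | zero => exact ⟨h1, h2, hD⟩
    | succ n ih =>
      obtain ⟨i1, i2, i3⟩ := ih
      rw [hs]
      refine ⟨?_, i2.union (i1.image φ), union_subset i3 ?_⟩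
      · have := i2.to_subtype
        exact i1.union ((countable_singleton _).union ((i1.image2 i1 _).union
          ((hQ.image2 i1 _).union (countable_iUnion fun p => hM _ _))))
      · rintro _ ⟨x, -, rfl⟩
        exact hφ x
  refine ⟨(⋃ n, (s n).1, ⋃ n, (s n).2), ⟨subset_iUnion (fun n => (s n).1) 0,
    subset_iUnion (fun n => (s n).2) 0⟩, countable_iUnion fun n => (hcount n).1,
    countable_iUnion fun n => (hcount n).2.1, ?_, ?_, ?_, iUnion_subset fun n => (hcount n).2.2,
    ?_, ?_⟩
  · refine mem_iUnion.2 ⟨1, ?_⟩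
    rw [hs 0]
    exact Or.inr (Or.inl rfl)
  · intro x hx y hy
    obtain ⟨n, hn⟩ := mem_iUnion.1 hx
    obtain ⟨k, hk⟩ := mem_iUnion.1 hy
    refine mem_iUnion.2 ⟨max n k + 1, ?_⟩
    rw [hs]
    exact Or.inr (Or.inr (Or.inl (mem_image2_of_mem (hmono1 (le_max_left n k) hn)
      (hmono1 (le_max_right n k) hk))))
  · intro q hq x hx
    obtain ⟨n, hn⟩ := mem_iUnion.1 hx
    refine mem_iUnion.2 ⟨n + 1, ?_⟩
    rw [hs]
    exact Or.inr (Or.inr (Or.inr (Or.inl (mem_image2_of_mem hq hn))))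
  · intro x hx
    obtain ⟨n, hn⟩ := mem_iUnion.1 hx
    refine mem_iUnion.2 ⟨n + 1, ?_⟩
    rw [hs]
    exact Or.inr (mem_image_of_mem φ hn)
  · intro f hf l hl m hm hfm
    obtain ⟨n, hn⟩ := List.exists_forall_mem_of_monotone hmono2 (f :: l)
      (by rintro g hg; rcases List.mem_cons.1 hg with rfl | hg; exacts [hf, hl g hg])
    refine mem_iUnion.2 ⟨n + 1, ?_⟩
    rw [hs]
    refine Or.inr (Or.inr (Or.inr (Or.inr (mem_iUnion.2
      ⟨(⟨f, hn f (by simp)⟩, l.attach.map fun g => ⟨g.1, hn g.1 (by simp [g.2])⟩), ?_, hfm⟩))))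
    simpa using hm

theorem IsSaturated.iUnion {s : ℕ → Set X × Set (StrongDual 𝕜 X)} (hs : Monotone s)
    (h : ∀ n, IsSaturated Q φ M D (s n)) :
    IsSaturated Q φ M D (⋃ n, (s n).1, ⋃ n, (s n).2) := by
  have hmono1 : Monotone fun n => (s n).1 := fun i j h => (hs h).1
  have hmono2 : Monotone fun n => (s n).2 := fun i j h => (hs h).2
  refine ⟨countable_iUnion fun n => (h n).countable_fst,
    countable_iUnion fun n => (h n).countable_snd, mem_iUnion.2 ⟨0, (h 0).zero_mem⟩, ?_, ?_,
    iUnion_subset fun n => (h n).subset, ?_, ?_⟩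
  · intro x hx y hy
    obtain ⟨n, hn⟩ := mem_iUnion.1 hx
    obtain ⟨k, hk⟩ := mem_iUnion.1 hy
    exact mem_iUnion.2 ⟨max n k, (h _).add_mem _ (hmono1 (le_max_left n k) hn) _
      (hmono1 (le_max_right n k) hk)⟩
  · intro q hq x hx
    obtain ⟨n, hn⟩ := mem_iUnion.1 hx
    exact mem_iUnion.2 ⟨n, (h n).smul_mem q hq x hn⟩
  · intro x hx
    obtain ⟨n, hn⟩ := mem_iUnion.1 hx
    exact mem_iUnion.2 ⟨n, (h n).functional_mem x hn⟩
  · intro f hf l hl m hm hfm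
    obtain ⟨n, hn⟩ := List.exists_forall_mem_of_monotone hmono2 (f :: l)
      (by rintro g hg; rcases List.mem_cons.1 hg with rfl | hg; exacts [hf, hl g hg])
    exact mem_iUnion.2 ⟨n, (h n).support_mem f (hn f (by simp)) l
      (fun g hg => hn g (by simp [hg])) m hm hfm⟩

/-- The closure of the set of vectors of a saturated pair, as a subspace. -/
def IsSaturated.closedSpan {S : Set X × Set (StrongDual 𝕜 X)} (h : IsSaturated Q φ M D S)
    (hQ : Dense Q) : Submodule 𝕜 X where
  carrier := closure S.1
  zero_mem' := subset_closure h.zero_mem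
  add_mem' hx hy := map_mem_closure₂ continuous_add hx hy h.add_mem
  smul_mem' c _ hx := map_mem_closure₂ continuous_smul (hQ c) hx h.smul_mem

/-- The common kernel of a set of functionals. -/
def commonKer (B : Set (StrongDual 𝕜 X)) : Submodule 𝕜 X :=
  ⨅ f ∈ B, LinearMap.ker f.toLinearMap

theorem mem_commonKer {B : Set (StrongDual 𝕜 X)} {x : X} :
    x ∈ commonKer B ↔ ∀ f ∈ B, f x = 0 := by
  simp [commonKer]

theorem isClosed_commonKer (B : Set (StrongDual 𝕜 X)) : IsClosed (commonKer B : Set X) := by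
  have : (commonKer B : Set X) = ⋂ f ∈ B, {x | f x = 0} := by
    ext x
    simp [mem_commonKer]
  rw [this]
  exact isClosed_biInter fun f _ => isClosed_eq f.continuous continuous_const

/-- If `φ x` norms `x` up to the constant `C`, then the common kernel of the functionals of a
saturated pair is uniformly transversal to the closure of its set of vectors. -/
theorem IsSaturated.norm_le {S : Set X × Set (StrongDual 𝕜 X)} (h : IsSaturated Q φ M D S)
    {C : ℝ} (hφ : ∀ x, φ x x = ‖x‖) (hC : ∀ x, ‖φ x‖ ≤ C) {y z : X} (hy : y ∈ closure S.1)
    (hz : z ∈ commonKer S.2) : ‖y‖ ≤ C * ‖y + z‖ := by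
  have hcl : IsClosed {y : X | ‖y‖ ≤ C * ‖y + z‖} :=
    isClosed_le continuous_norm (by fun_prop)
  refine closure_minimal (fun x hx => ?_) hcl hy
  have h0 : φ x (x + z) = ‖x‖ := by
    rw [map_add, mem_commonKer.1 hz _ (h.functional_mem x hx), add_zero, hφ]
  calc ‖x‖ = ‖φ x (x + z)‖ := by rw [h0]; simp
    _ ≤ ‖φ x‖ * ‖x + z‖ := (φ x).le_opNorm _
    _ ≤ C * ‖x + z‖ := by gcongr; exact hC x

end Saturated

/-! ### From the given family to a single projection -/

section Family

variable {𝕜 : Type u} [RCLike 𝕜] {X : Type v} [NormedAddCommGroup X] [NormedSpace 𝕜 X]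

/-- The set witnessing that a subspace is weakly Lindelöf determined, seen in the whole space. -/
theorem IsWLD.exists_subset {Y : Submodule 𝕜 X} (h : IsWLD 𝕜 Y) :
    ∃ M : Set X, (Y : Set X) ⊆ closure (Submodule.span 𝕜 M) ∧
      ∀ f : StrongDual 𝕜 X, {m ∈ M | f m ≠ 0}.Countable := by
  obtain ⟨M, hd, hM⟩ := h
  refine ⟨Subtype.val '' M, fun y hy => ?_, fun f => ?_⟩
  · have h1 := image_closure_subset_closure_image (f := Subtype.val) continuous_subtype_val
      (mem_image_of_mem Subtype.val (hd ⟨y, hy⟩))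
    have h2 : Subtype.val '' (Submodule.span 𝕜 M : Set Y) =
        (Submodule.span 𝕜 (Subtype.val '' M) : Set X) := by
      simpa using congrArg (fun W : Submodule 𝕜 X => (W : Set X))
        (Submodule.map_span Y.subtype M)
    rwa [h2] at h1
  · have h1 : f.comp Y.subtypeL ∈ {f : StrongDual 𝕜 Y | {m ∈ M | f m ≠ 0}.Countable} := by
      rw [← hM]
      trivial
    refine (h1.image Subtype.val).mono ?_
    rintro _ ⟨⟨m, hm, rfl⟩, hfm⟩
    exact ⟨m, ⟨hm, hfm⟩, rfl⟩

/-- Every vector is normed, up to a uniform constant, by a functional of the induced subspace. -/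
theorem exists_norming_mem_inducedSubspace {L : Type w} {R : L → X →L[𝕜] X}
    (projection : ∀ l, R l ∘L R l = R l) {C : ℝ}
    (bounded : ∀ l, ‖R l‖ ≤ C) (cover : ⋃ l, range (R l) = univ) (x : X) :
    ∃ f ∈ inducedSubspace R, f x = ‖x‖ ∧ ‖f‖ ≤ C := by
  obtain ⟨l, z, hz⟩ := mem_iUnion.1 (cover ▸ mem_univ x : x ∈ ⋃ l, range (R l))
  -- Here `‖g‖ ≤ 1`, which also covers `x = 0`; as `R l` fixes `x`, the functional `g ∘ R l` still
  -- norms it.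
  obtain ⟨g, hg, hgx⟩ := exists_dual_vector'' 𝕜 x
  have hx : R l x = x := by
    rw [← hz, ← ContinuousLinearMap.comp_apply, projection]
  refine ⟨g ∘L R l, mem_iUnion.2 ⟨l, g, rfl⟩, by simp [hx, hgx], ?_⟩
  calc ‖g ∘L R l‖ ≤ ‖g‖ * ‖R l‖ := g.opNorm_comp_le _
    _ ≤ 1 * C := by gcongr; exact bounded l
    _ = C := one_mul C

variable {L : Type w} [Preorder L] {R : L → X →L[𝕜] X}

theorem comp_eq_of_le (compatible : ∀ l m, l ≤ m → R l ∘L R m = R l ∧ R m ∘L R l = R l)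
    {f : StrongDual 𝕜 X} {l m : L} (hlm : l ≤ m) (hf : f ∘L R l = f) : f ∘L R m = f := by
  rw [← hf, ContinuousLinearMap.comp_assoc, (compatible l m hlm).1]

/-- One can attach to each finite list of functionals an index such that longer lists get larger
indices and such that the members of the list in the induced subspace are fixed by the adjoint of
the corresponding operator. -/
theorem exists_list_index [Nonempty L] (directed : ∀ l m : L, ∃ k, l ≤ k ∧ m ≤ k)
    (projection : ∀ l, R l ∘L R l = R l)
    (compatible : ∀ l m, l ≤ m → R l ∘L R m = R l ∧ R m ∘L R l = R l) :
    ∃ lam : List (StrongDual 𝕜 X) → L, ∀ f l, lam l ≤ lam (f :: l) ∧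
      (f ∈ inducedSubspace R → f ∘L R (lam (f :: l)) = f) := by
  have key : ∀ (f : StrongDual 𝕜 X) (l : L),
      ∃ k, l ≤ k ∧ (f ∈ inducedSubspace R → f ∘L R k = f) := by
    intro f l
    by_cases hf : f ∈ inducedSubspace R
    · obtain ⟨m, g, rfl⟩ := mem_iUnion.1 hf
      obtain ⟨k, hl, hm⟩ := directed l m
      refine ⟨k, hl, fun _ => comp_eq_of_le compatible hm ?_⟩
      simp only [ContinuousLinearMap.comp_assoc, projection]
    · exact ⟨l, le_rfl, fun h => absurd h hf⟩
  choose up hup using key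
  exact ⟨List.foldr up (Classical.arbitrary L), fun f l => hup f _⟩

/-- For a countable set `B` in the induced subspace, one of the operators fixes `B`, and its range
is the closure of the union of the ranges attached to finite lists in `B`. -/
theorem exists_fixing_index
    (compatible : ∀ l m, l ≤ m → R l ∘L R m = R l ∧ R m ∘L R l = R l)
    (sup_complete : ∀ s : ℕ → L, Monotone s →
      ∃ l, IsLUB (range s) l ∧ range (R l) = closure (⋃ n, range (R (s n))))
    {lam : List (StrongDual 𝕜 X) → L} (hlam : ∀ f l, lam l ≤ lam (f :: l) ∧
      (f ∈ inducedSubspace R → f ∘L R (lam (f :: l)) = f))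
    {B : Set (StrongDual 𝕜 X)} (hB : B.Countable) (hne : B.Nonempty)
    (hBD : B ⊆ inducedSubspace R) :
    ∃ k, (∀ f ∈ B, f ∘L R k = f) ∧ range (R k) ⊆
      closure (⋃ l ∈ {l : List (StrongDual 𝕜 X) | ∀ g ∈ l, g ∈ B}, range (R (lam l))) := by
  obtain ⟨b, rfl⟩ := hB.exists_eq_range hne
  -- `l n` lists `b 0, …, b (n - 1)`, latest first, so the index of `l (n + 1)` is the one that
  -- fixes `b n`.
  let l : ℕ → List (StrongDual 𝕜 X) := fun n => Nat.rec [] (fun n l => b n :: l) n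
  have hl : ∀ n, ∀ g ∈ l n, g ∈ range b := by
    intro n
    induction n with
    | zero => intro g hg; exact absurd hg (by simp [l])
    | succ n ih =>
      intro g hg
      rcases List.mem_cons.1 (show g ∈ b n :: l n from hg) with rfl | hg
      exacts [mem_range_self n, ih g hg]
  obtain ⟨k, hk, hr⟩ := sup_complete (fun n => lam (l n))
    (monotone_nat_of_le_succ fun n => (hlam (b n) (l n)).1)
  refine ⟨k, ?_, ?_⟩
  · rintro _ ⟨n, rfl⟩
    exact comp_eq_of_le compatible (hk.1 (mem_range_self (n + 1)))
      ((hlam (b n) (l n)).2 (hBD (mem_range_self n)))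
  · rw [hr]
    exact closure_mono (iUnion_subset fun n => subset_biUnion_of_mem
      (u := fun l => range (R (lam l))) (hl n))

/-- The projection attached to a saturated pair: its range is the closure of the set of vectors,
its kernel the common kernel of the functionals, and it factors through some `R k`. -/
theorem IsSaturated.exists_projection [CompleteSpace X]
    (compatible : ∀ l m, l ≤ m → R l ∘L R m = R l ∧ R m ∘L R l = R l)
    (sup_complete : ∀ s : ℕ → L, Monotone s →
      ∃ l, IsLUB (range s) l ∧ range (R l) = closure (⋃ n, range (R (s n))))
    {lam : List (StrongDual 𝕜 X) → L} (hlam : ∀ f l, lam l ≤ lam (f :: l) ∧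
      (f ∈ inducedSubspace R → f ∘L R (lam (f :: l)) = f))
    {Q : Set 𝕜} (hQ : Dense Q) {φ : X → StrongDual 𝕜 X} (hφ : ∀ x, φ x x = ‖x‖) {C : ℝ}
    (hC : ∀ x, ‖φ x‖ ≤ C) {M : L → Set X}
    (hM : ∀ l, range (R l) ⊆ closure (Submodule.span 𝕜 (M l)))
    {S : Set X × Set (StrongDual 𝕜 X)}
    (h : IsSaturated Q φ (fun l => M (lam l)) (inducedSubspace R) S) :
    ∃ P : X →L[𝕜] X, (∀ x, P x ∈ closure S.1) ∧ (∀ x, x - P x ∈ commonKer S.2) ∧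
      (∀ y ∈ closure S.1, P y = y) ∧ (∀ z ∈ commonKer S.2, P z = 0) ∧ ‖P‖ ≤ C ∧
      ∃ k, P ∘L R k = P := by
  obtain ⟨k, hk, hr⟩ := exists_fixing_index compatible sup_complete hlam h.countable_snd
    ⟨_, h.functional_mem 0 h.zero_mem⟩ h.subset
  have hker : ∀ x, x - R k x ∈ commonKer S.2 := fun x => mem_commonKer.2 fun f hf => by
    rw [map_sub, ← ContinuousLinearMap.comp_apply, hk f hf, sub_self]
  have hd : Dense ((h.closedSpan hQ ⊔ commonKer S.2 : Submodule 𝕜 X) : Set X) := by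
    rw [Submodule.dense_iff_topologicalClosure_eq_top, eq_top_iff]
    intro x _
    set W := (h.closedSpan hQ ⊔ commonKer S.2).topologicalClosure with hW
    have hWc : IsClosed (W : Set X) := Submodule.isClosed_topologicalClosure _
    have hle : h.closedSpan hQ ⊔ commonKer S.2 ≤ W := Submodule.le_topologicalClosure _
    have hRk : range (R k) ⊆ W := by
      refine hr.trans (closure_minimal (iUnion₂_subset fun l hl => (hM _).trans
        (closure_minimal (Submodule.span_le.2 fun m hm => ?_) hWc)) hWc)
      -- If some `f ∈ S.2` were nonzero at `m`, saturation would put `m` in `S.1`.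
      by_cases hmS : m ∈ S.1
      · exact hle (Submodule.mem_sup_left (show m ∈ closure S.1 from subset_closure hmS))
      · refine hle (Submodule.mem_sup_right (mem_commonKer.2 fun f hf => ?_))
        by_contra hfm
        exact hmS (h.support_mem f hf l hl m hm hfm)
    have := W.add_mem (hle (Submodule.mem_sup_right (hker x))) (hRk (mem_range_self x))
    simpa using this
  obtain ⟨P, h1, h2, h3, h4, h5⟩ := Submodule.exists_projection_of_dense_sup
    (Y := h.closedSpan hQ) isClosed_closure (isClosed_commonKer S.2)
    ((norm_nonneg _).trans (hC 0)) (fun y hy z hz => h.norm_le hφ hC hy hz) hd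
  refine ⟨P, h1, h2, h3, h4, h5, k, ContinuousLinearMap.ext fun x => ?_⟩
  have := h4 _ (hker x)
  rw [map_sub, sub_eq_zero] at this
  exact this.symm

end Family

/-! ### Change of index set and universe -/

section Reindex

variable {𝕜 : Type u} [RCLike 𝕜] {X : Type v} [NormedAddCommGroup X] [NormedSpace 𝕜 X]

theorem IsProjectionalSkeleton.comp_orderIso {I : Type*} {J : Type*} [PartialOrder I]
    [PartialOrder J] {P : I → X →L[𝕜] X} (h : IsProjectionalSkeleton P) (e : J ≃o I) :
    IsProjectionalSkeleton (P ∘ e) where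
  directed i j := by
    obtain ⟨k, hi, hj⟩ := h.directed (e i) (e j)
    exact ⟨e.symm k, e.le_symm_apply.2 hi, e.le_symm_apply.2 hj⟩
  projection i := h.projection (e i)
  bounded := h.bounded.imp fun C hC i => hC (e i)
  separable i := h.separable (e i)
  compatible i j hij := h.compatible _ _ (e.monotone hij)
  sup_complete s hs := by
    obtain ⟨i, hi, hr⟩ := h.sup_complete (e ∘ s) (e.monotone.comp hs)
    refine ⟨e.symm i, ?_, by simpa using hr⟩
    rwa [← e.isLUB_image', ← range_comp, e.apply_symm_apply]
  cover := by
    rw [← h.cover]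
    exact e.surjective.iUnion_comp fun i => range (P i)

theorem inducedSubspace_comp_equiv {I : Type*} {J : Type*} (P : I → X →L[𝕜] X) (e : J ≃ I) :
    inducedSubspace (P ∘ e) = inducedSubspace P :=
  e.surjective.iUnion_comp fun i => range fun f : StrongDual 𝕜 X => f.comp (P i)

theorem RCLike.small (𝕜 : Type u) [RCLike 𝕜] : Small.{v} 𝕜 :=
  have : Small.{v} ℝ := small_lift ℝ
  small_of_injective (f := fun z : 𝕜 => (RCLike.re z, RCLike.im z)) fun _ _ h =>
    RCLike.ext (congrArg Prod.fst h) (congrArg Prod.snd h)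

/-- A functional is a function from `X` to `𝕜`, and `𝕜` embeds in `ℝ × ℝ`. Hence saturated pairs can
be indexed in the universe of `X`. -/
theorem small_strongDual : Small.{v} (StrongDual 𝕜 X) :=
  have := RCLike.small.{u, v} 𝕜
  small_of_injective (DFunLike.coe_injective : Function.Injective fun (f : StrongDual 𝕜 X) x => f x)

end Reindex

/-! ### The skeleton of saturated pairs -/

theorem theoremT {𝕜 : Type u} [RCLike 𝕜] {X : Type v} [NormedAddCommGroup X] [NormedSpace 𝕜 X]
    [CompleteSpace X] {L : Type w} [Preorder L]
    (R : L → X →L[𝕜] X)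
    (directed : ∀ l m : L, ∃ k, l ≤ k ∧ m ≤ k)
    (projection : ∀ l, R l ∘L R l = R l)
    (bounded : ∃ C : ℝ, ∀ l, ‖R l‖ ≤ C)
    (wld : ∀ l, IsWLD 𝕜 (R l).range)
    (compatible : ∀ l m, l ≤ m → R l ∘L R m = R l ∧ R m ∘L R l = R l)
    (sup_complete : ∀ s : ℕ → L, Monotone s →
      ∃ l, IsLUB (Set.range s) l ∧ Set.range (R l) = closure (⋃ n, Set.range (R (s n))))
    (cover : ⋃ l, Set.range (R l) = Set.univ) :
    ∃ (I : Type v) (_ : PartialOrder I) (P : I → X →L[𝕜] X),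
      IsProjectionalSkeleton P ∧ inducedSubspace P = inducedSubspace R := by
  obtain ⟨C, hC⟩ := bounded
  have hne : Nonempty L := by
    obtain ⟨l, -⟩ := mem_iUnion.1 (cover ▸ mem_univ 0 : (0 : X) ∈ ⋃ l, range (R l))
    exact ⟨l⟩
  choose M hM hMc using fun l => (wld l).exists_subset
  have hM' : ∀ l, range (R l) ⊆ closure (Submodule.span 𝕜 (M l)) := fun l => by
    simpa only [LinearMap.coe_range, ContinuousLinearMap.coe_coe] using hM l
  obtain ⟨lam, hlam⟩ := exists_list_index directed projection compatible
  choose φ hφD hφ hφC using exists_norming_mem_inducedSubspace projection hC cover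
  obtain ⟨Q, hQc, hQ⟩ := TopologicalSpace.exists_countable_dense 𝕜
  let I := {S : Set X × Set (StrongDual 𝕜 X) //
    IsSaturated Q φ (fun l => M (lam l)) (inducedSubspace R) S}
  have hcofinal : ∀ S : Set X × Set (StrongDual 𝕜 X), S.1.Countable → S.2.Countable →
      S.2 ⊆ inducedSubspace R → ∃ i : I, S ≤ i.1 := fun S h1 h2 h3 => by
    obtain ⟨T, hST, hT⟩ := exists_isSaturated_ge hQc hφD (fun l => hMc (lam l)) h1 h2 h3
    exact ⟨⟨T, hT⟩, hST⟩
  choose P hPmem hPker hPfix hPzero hPC hPR using fun i : I =>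
    i.2.exists_projection compatible sup_complete hlam hQ hφ hφC hM'
  have hrange : ∀ i, range (P i) = closure i.1.1 := fun i =>
    Subset.antisymm (range_subset_iff.2 (hPmem i)) fun y hy => ⟨y, hPfix i y hy⟩
  have hfix : ∀ i, ∀ f ∈ i.1.2, f ∘L P i = f := fun i f hf => ContinuousLinearMap.ext fun x => by
    have := mem_commonKer.1 (hPker i x) f hf
    rw [map_sub, sub_eq_zero] at this
    exact this.symm
  suffices h : IsProjectionalSkeleton P ∧ inducedSubspace P = inducedSubspace R by
    have := small_strongDual (𝕜 := 𝕜) (X := X)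
    have : Small.{v} I := small_subtype _ _
    let e : Shrink.{v} I ≃ I := (equivShrink I).symm
    let := PartialOrder.lift e e.injective
    let e' : Shrink.{v} I ≃o I := ⟨e, Iff.rfl⟩
    exact ⟨Shrink.{v} I, this, P ∘ e', h.1.comp_orderIso e',
      (inducedSubspace_comp_equiv P e).trans h.2⟩
  refine ⟨⟨?_, ?_, ⟨C, hPC⟩, ?_, ?_, ?_, ?_⟩, ?_⟩
  · intro i j
    obtain ⟨k, hk⟩ := hcofinal (i.1 ⊔ j.1) (i.2.countable_fst.union j.2.countable_fst)
      (i.2.countable_snd.union j.2.countable_snd) (union_subset i.2.subset j.2.subset)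
    exact ⟨k, le_sup_left.trans hk, le_sup_right.trans hk⟩
  · exact fun i => ContinuousLinearMap.ext fun x => hPfix i _ (hPmem i x)
  · intro i
    rw [hrange]
    exact i.2.countable_fst.isSeparable.closure
  · intro i j hij
    refine ⟨ContinuousLinearMap.ext fun x => ?_, ContinuousLinearMap.ext fun x =>
      hPfix j _ (closure_mono hij.1 (hPmem i x))⟩
    -- A larger pair has more functionals, so the kernel of `P j` lies in that of `P i`.
    have := hPzero i _ (mem_commonKer.2 fun f hf => mem_commonKer.1 (hPker j x) f (hij.2 hf))
    rw [map_sub, sub_eq_zero] at this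
    exact this.symm
  · intro s hs
    refine ⟨⟨_, IsSaturated.iUnion (s := fun n => (s n).1) hs fun n => (s n).2⟩, ⟨?_, ?_⟩, ?_⟩
    · rintro _ ⟨n, rfl⟩
      exact ⟨subset_iUnion (fun n => (s n).1.1) n, subset_iUnion (fun n => (s n).1.2) n⟩
    · intro j hj
      exact ⟨iUnion_subset fun n => (hj (mem_range_self n)).1,
        iUnion_subset fun n => (hj (mem_range_self n)).2⟩
    · simp only [hrange]
      refine Subset.antisymm (closure_mono (iUnion_mono fun n => subset_closure)) ?_
      exact closure_minimal (iUnion_subset fun n => closure_mono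
        (subset_iUnion (fun n => (s n).1.1) n)) isClosed_closure
  · refine eq_univ_of_forall fun x => ?_
    obtain ⟨i, hi⟩ := hcofinal ({x}, ∅) (countable_singleton x) countable_empty (empty_subset _)
    exact mem_iUnion.2 ⟨i, x, hPfix i x (subset_closure (hi.1 rfl))⟩
  · refine Subset.antisymm ?_ fun f hf => ?_
    · rintro f hf
      obtain ⟨i, g, rfl⟩ := mem_iUnion.1 hf
      obtain ⟨k, hk⟩ := hPR i
      exact mem_iUnion.2 ⟨k, g ∘L P i, by
        simp only [ContinuousLinearMap.comp_assoc, hk]⟩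
    · obtain ⟨i, hi⟩ := hcofinal (∅, {f}) countable_empty (countable_singleton f)
        (singleton_subset_iff.2 hf)
      exact mem_iUnion.2 ⟨i, f, hfix i f (hi.2 rfl)⟩
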